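/- Let $\mathcal H$ be a separable complex Hilbert space and let $U$ be a unitary operator on $\mathcal H$. A conjugation on $\mathcal H$ is a map $C:\mathcal H\to\mathcal H$ that is antilinear, isometric and satisfies $C^2=I$; put $\mathfrak O_c(U)=\{CUC : C \text{ is a conjugation on }\mathcal H\}$. The operator $U$ has a spectral measure, i.e. there is a projection-valued measure $E$ on the Borel subsets of the unit circle $\mathbb T$ with $U=\int_{\mathbb T}\xi\,dE(\xi)$. For a vector $v$ let $\mathcal H(v)$ be the closed complex linear span, and $\mathcal H(v)_{\mathbb R}$ the closed real linear span, of $\{E(\Omega)v:\Omega\subset\mathbb T\text{ Borel}\}$. There is a finite or infinite orthonormal sequence $(x_k)$ in $\mathcal H$ such that the subspaces $\mathcal H(x_k)$ are pairwise orthogonal and $\mathcal H=\bigoplus_k\mathcal H(x_k)$. Fix any such $(x_k)$ and put $\mathcal H_{\mathbb R}=\bigoplus_k\mathcal H(x_k)_{\mathbb R}$, a real Hilbert space under the restriction of the inner product of $\mathcal H$ (which is real-valued on $\mathcal H_{\mathbb R}$). Let $\mathfrak C(\mathcal H_{\mathbb R})$ be its complexification: the pairs $\begin{bmatrix}h\\g\end{bmatrix}$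 with $h,g\in\mathcal H_{\mathbb R}$, componentwise addition, $$(s+it)\begin{bmatrix}h\\g\end{bmatrix}=\begin{bmatrix}sh-tg\\sg+th\end{bmatrix},\qquad \Big\langle\begin{bmatrix}h\\g\end{bmatrix},\begin{bmatrix}h'\\g'\end{bmatrix}\Big\rangle=\langle h,h'\rangle+\langle g,g'\rangle+i\big(\langle g,h'\rangle-\langle h,g'\rangle\big).$$ Let $X:\mathcal H\to\mathfrak C(\mathcal H_{\mathbb R})$ be the isometric isomorphism $X(h+ig)=\begin{bmatrix}h\\g\end{bmatrix}$ $(h,g\in\mathcal H_{\mathbb R})$, and for a bounded operator $A$ on $\mathcal H$ write $\widehat A=XAX^{-1}$. Then for every unitary operator $V$ on $\mathcal H$ the following are equivalent. (a) $V\in\mathfrak O_c(U)$. (b) $V=WU^*W^*$ for some operator $W$ on $\mathcal H$ with $\widehat W=\begin{bmatrix}W_r&-W_c\\W_c&W_r\end{bmatrix}$, where $W_r,W_c$ are bounded real linear operators on $\mathcal H_{\mathbb R}$ satisfying $$W_r^\dagger=W_r,\quad W_c^\dagger=W_c,\quad W_rW_c=W_cW_r,\quad W_r^2+W_c^2=I,\tag{1}$$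 where $\dagger$ denotes the adjoint on the real Hilbert space $\mathcal H_{\mathbb R}$. (c) There are bounded real linear operators $W_r,W_c$ on $\mathcal H_{\mathbb R}$ satisfying (1) such that, with $\widehat W=\begin{bmatrix}W_r&-W_c\\W_c&W_r\end{bmatrix}$ on $\mathfrak C(\mathcal H_{\mathbb R})$, $\widehat V=\widehat W\,\widehat U^{*}\,\widehat W^{*}$. -/

import Mathlib

open MeasureTheory Complex
open scoped InnerProductSpace ComplexConjugate

noncomputable section

/-! ### Conjugations and the conjugate orbit -/

/-- A conjugation: an antilinear, involutive isometry of a complex Hilbert space. -/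
structure IsConjugation {H : Type*} [NormedAddCommGroup H] [InnerProductSpace ℂ H]
    (C : H → H) : Prop where
  antilinear : ∀ (a : ℂ) (x y : H), C (a • x + y) = conj a • C x + C y
  involutive : ∀ x : H, C (C x) = x
  isometric : ∀ x : H, ‖C x‖ = ‖x‖

/-- The conjugate orbit `{C U C : C a conjugation}`. -/
def conjugateOrbit {H : Type*} [NormedAddCommGroup H] [InnerProductSpace ℂ H]
    (U : H →L[ℂ] H) : Set (H →L[ℂ] H) :=
  {V | ∃ C : H → H, IsConjugation C ∧ ∀ x, V x = C (U (C x))}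

/-! ### Spectral measures on the unit circle -/

/-- The Borel sigma-algebra of the unit circle. -/
instance instMeasurableSpaceCircle : MeasurableSpace Circle := borel Circle

instance instBorelSpaceCircle : BorelSpace Circle := ⟨rfl⟩

/-- A spectral (projection-valued) measure on the Borel subsets of the unit circle: the values
are orthogonal projections, multiplicative under intersection, normalized, and countably additive
in the strong operator topology. Only the values on Borel sets matter. -/
structure SpectralMeasure (H : Type*) [NormedAddCommGroup H] [InnerProductSpace ℂ H]
    [CompleteSpace H] where
  proj : Set Circle → H →L[ℂ] H
  isStarProjection : ∀ Ω, MeasurableSet Ω → IsStarProjection (proj Ω)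
  empty : proj ∅ = 0
  univ : proj Set.univ = 1
  inter : ∀ Ω₁ Ω₂, MeasurableSet Ω₁ → MeasurableSet Ω₂ →
    proj (Ω₁ ∩ Ω₂) = proj Ω₁ * proj Ω₂
  iUnion : ∀ Ω : ℕ → Set Circle, (∀ n, MeasurableSet (Ω n)) →
    Pairwise (Function.onFun Disjoint Ω) →
      ∀ h : H, HasSum (fun n => proj (Ω n) h) (proj (⋃ n, Ω n) h)

namespace SpectralMeasure

variable {H : Type*} [NormedAddCommGroup H] [InnerProductSpace ℂ H] [CompleteSpace H]

theorem inner_proj (E : SpectralMeasure H) {Ω₁ Ω₂ : Set Circle} (h₁ : MeasurableSet Ω₁)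
    (h₂ : MeasurableSet Ω₂) (v w : H) :
    ⟪E.proj Ω₁ v, E.proj Ω₂ w⟫_ℂ = ⟪v, E.proj (Ω₁ ∩ Ω₂) w⟫_ℂ := by
  rw [← ContinuousLinearMap.adjoint_inner_right, E.inter _ _ h₁ h₂]
  have := (E.isStarProjection _ h₁).isSelfAdjoint
  rw [ContinuousLinearMap.isSelfAdjoint_iff'] at this
  rw [this]; rfl

theorem inner_proj_self (E : SpectralMeasure H) {Ω : Set Circle} (h : MeasurableSet Ω) (v : H) :
    ⟪v, E.proj Ω v⟫_ℂ = ((‖E.proj Ω v‖ ^ 2 : ℝ) : ℂ) := by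
  have := E.inner_proj h h v v
  rw [Set.inter_self] at this
  rw [← this, inner_self_eq_norm_sq_to_K]
  simp

/-- The finite positive Borel measure `Ω ↦ ⟨E(Ω) h, h⟩ = ‖E(Ω) h‖²`. -/
def scalarMeasure (E : SpectralMeasure H) (h : H) : Measure Circle :=
  Measure.ofMeasurable (fun Ω _ => ENNReal.ofReal (‖E.proj Ω h‖ ^ 2))
    (by simp [E.empty])
    (by
      intro Ω hΩ hd
      have h1 := (E.iUnion Ω hΩ hd h).mapL (innerSL ℂ h)
      simp only [innerSL_apply_apply] at h1
      rw [E.inner_proj_self (MeasurableSet.iUnion hΩ)] at h1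
      simp_rw [E.inner_proj_self (hΩ _)] at h1
      have h2 := Complex.hasSum_ofReal.mp h1
      rw [← h2.tsum_eq, ENNReal.ofReal_tsum_of_nonneg (fun n => sq_nonneg _) h2.summable])

/-- `U = ∫ ξ dE(ξ)`, i.e. `⟨U h, h⟩ = ∫ ξ d⟨E(ξ) h, h⟩` for all `h` (which determines all
`⟨U h, g⟩` by polarization). -/
def IsSpectralMeasureOf (E : SpectralMeasure H) (U : H →L[ℂ] H) : Prop :=
  ∀ h : H, ⟪h, U h⟫_ℂ = ∫ ξ : Circle, (ξ : ℂ) ∂(E.scalarMeasure h)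

/-! ### The spectral cyclic decomposition and the real form of `H` -/

/-- `H(v)`: the closed complex linear span of the vectors `E(Ω) v`, `Ω` Borel. -/
def cyclicSubspace (E : SpectralMeasure H) (v : H) : Submodule ℂ H :=
  (Submodule.span ℂ {w | ∃ Ω, MeasurableSet Ω ∧ w = E.proj Ω v}).topologicalClosure

/-- `H(v)_ℝ`: the closed real linear span of the vectors `E(Ω) v`, `Ω` Borel. -/
def realCyclicSubspace (E : SpectralMeasure H) (v : H) : Submodule ℝ H :=
  (Submodule.span ℝ {w | ∃ Ω, MeasurableSet Ω ∧ w = E.proj Ω v}).topologicalClosure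

/-- `(x k)` is an orthonormal family and `H` is the orthogonal Hilbert space sum of the
subspaces `H(x k)`. -/
structure IsCyclicDecomposition (E : SpectralMeasure H) {ι : Type*} (x : ι → H) : Prop where
  orthonormal : Orthonormal ℂ x
  orthogonal : ∀ j k, j ≠ k → E.cyclicSubspace (x j) ⟂ E.cyclicSubspace (x k)
  total : (⨆ k, E.cyclicSubspace (x k)).topologicalClosure = ⊤

/-- `H_ℝ`: the Hilbert space sum (inside `H`) of the real subspaces `H(x k)_ℝ`. -/
def realForm (E : SpectralMeasure H) {ι : Type*} (x : ι → H) : Submodule ℝ H :=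
  (⨆ k, E.realCyclicSubspace (x k)).topologicalClosure

instance (E : SpectralMeasure H) {ι : Type*} (x : ι → H) : CompleteSpace (E.realForm x) :=
  Submodule.topologicalClosure.completeSpace _

/-- The real inner product of `H_ℝ` is the restriction of the inner product of `H`; the latter is
real-valued on `H_ℝ` (see `inner_im_eq_zero`), so taking real parts changes nothing. -/
instance (E : SpectralMeasure H) {ι : Type*} (x : ι → H) :
    InnerProductSpace ℝ (E.realForm x) where
  inner a b := (⟪(a : H), (b : H)⟫_ℂ).re
  norm_sq_eq_re_inner a := by
    simpa using norm_sq_eq_re_inner (𝕜 := ℂ) (a : H)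
  conj_inner_symm a b := by
    simpa using inner_re_symm (𝕜 := ℂ) (b : H) (a : H)
  add_left a b c := by simp
  smul_left a b r := by
    rw [Submodule.coe_smul, ← Complex.coe_smul, inner_smul_left]
    simp

theorem real_inner_def (E : SpectralMeasure H) {ι : Type*} (x : ι → H) (a b : E.realForm x) :
    ⟪a, b⟫_ℝ = (⟪(a : H), (b : H)⟫_ℂ).re := rfl

/-- The vectors whose inner product with `b` is real. -/
def realInnerSubspace (b : H) : Submodule ℝ H where
  carrier := {a | (⟪b, a⟫_ℂ).im = 0}
  add_mem' {u v} hu hv := by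
    simp only [Set.mem_ofPred_eq] at hu hv ⊢
    rw [inner_add_right, Complex.add_im, hu, hv, add_zero]
  zero_mem' := by simp
  smul_mem' r u hu := by
    simp only [Set.mem_ofPred_eq] at hu ⊢
    rw [← Complex.coe_smul, inner_smul_right, Complex.im_ofReal_mul, hu, mul_zero]

theorem realForm_le_realInnerSubspace (E : SpectralMeasure H) {ι : Type*} (x : ι → H) (b : H)
    (hb : ∀ k Ω, MeasurableSet Ω → (⟪b, E.proj Ω (x k)⟫_ℂ).im = 0) :
    E.realForm x ≤ realInnerSubspace b := by
  have hc : IsClosed (realInnerSubspace b : Set H) :=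
    isClosed_eq (f := fun a => (⟪b, a⟫_ℂ).im) (by fun_prop) continuous_const
  refine Submodule.topologicalClosure_minimal _ (iSup_le fun k => ?_) hc
  refine Submodule.topologicalClosure_minimal _ (Submodule.span_le.2 ?_) hc
  rintro _ ⟨Ω, hΩ, rfl⟩
  exact hb k Ω hΩ

theorem proj_mem_cyclicSubspace (E : SpectralMeasure H) (v : H) {Ω : Set Circle}
    (hΩ : MeasurableSet Ω) : E.proj Ω v ∈ E.cyclicSubspace v :=
  Submodule.le_topologicalClosure _ (Submodule.subset_span ⟨Ω, hΩ, rfl⟩)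

theorem proj_mem_realForm (E : SpectralMeasure H) {ι : Type*} (x : ι → H) (k : ι)
    {Ω : Set Circle} (hΩ : MeasurableSet Ω) : E.proj Ω (x k) ∈ E.realForm x :=
  Submodule.le_topologicalClosure _ <| Submodule.mem_iSup_of_mem k <|
    Submodule.le_topologicalClosure _ (Submodule.subset_span ⟨Ω, hΩ, rfl⟩)

/-- The inner product of `H` is real-valued on `H_ℝ`. -/
theorem inner_im_eq_zero (E : SpectralMeasure H) {ι : Type*} {x : ι → H}
    (hx : E.IsCyclicDecomposition x) {a b : H} (ha : a ∈ E.realForm x) (hb : b ∈ E.realForm x) :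
    (⟪a, b⟫_ℂ).im = 0 := by
  refine E.realForm_le_realInnerSubspace x a (fun k Ω hΩ => ?_) hb
  have h : a ∈ realInnerSubspace (E.proj Ω (x k)) := by
    refine E.realForm_le_realInnerSubspace x _ (fun j Ω' hΩ' => ?_) ha
    by_cases hjk : j = k
    · subst hjk
      rw [E.inner_proj hΩ hΩ', E.inner_proj_self (hΩ.inter hΩ'), Complex.ofReal_im]
    · rw [(Submodule.isOrtho_iff_inner_eq.1 (hx.orthogonal k j (Ne.symm hjk))) _
        (E.proj_mem_cyclicSubspace _ hΩ) _ (E.proj_mem_cyclicSubspace _ hΩ'), Complex.zero_im]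
  have h' : (⟪E.proj Ω (x k), a⟫_ℂ).im = 0 := h
  rw [← inner_conj_symm, Complex.conj_im, h', neg_zero]

end SpectralMeasure

/-! ### The complexification of a real Hilbert space -/

/-- The complexification `𝔆(K)`: pairs of vectors of the real Hilbert space `K`, with the norm
`‖(h, g)‖² = ‖h‖² + ‖g‖²` and the complex structure given below. -/
def Complexification (K : Type*) : Type _ := WithLp 2 (K × K)

namespace Complexification

/-- The pair `(h, g)`, thought of as `h + i g`. -/
def mk {K : Type*} (h g : K) : Complexification K := WithLp.toLp 2 (h, g)

/-- The first (real) component. -/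
def fst {K : Type*} (z : Complexification K) : K := (WithLp.ofLp z).1

/-- The second (imaginary) component. -/
def snd {K : Type*} (z : Complexification K) : K := (WithLp.ofLp z).2

@[ext] theorem ext {K : Type*} {z w : Complexification K} (h₁ : z.fst = w.fst)
    (h₂ : z.snd = w.snd) : z = w :=
  (WithLp.equiv 2 (K × K)).injective (Prod.ext h₁ h₂)

@[simp] theorem fst_mk {K : Type*} (h g : K) : (mk h g).fst = h := rfl
@[simp] theorem snd_mk {K : Type*} (h g : K) : (mk h g).snd = g := rfl

section

variable {K : Type*} [NormedAddCommGroup K]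

instance : NormedAddCommGroup (Complexification K) :=
  inferInstanceAs (NormedAddCommGroup (WithLp 2 (K × K)))

instance [CompleteSpace K] : CompleteSpace (Complexification K) :=
  inferInstanceAs (CompleteSpace (WithLp 2 (K × K)))

@[simp] theorem fst_add (z w : Complexification K) : (z + w).fst = z.fst + w.fst := rfl
@[simp] theorem snd_add (z w : Complexification K) : (z + w).snd = z.snd + w.snd := rfl
@[simp] theorem fst_zero : (0 : Complexification K).fst = 0 := rfl
@[simp] theorem snd_zero : (0 : Complexification K).snd = 0 := rfl

theorem norm_sq_eq (z : Complexification K) : ‖z‖ ^ 2 = ‖z.fst‖ ^ 2 + ‖z.snd‖ ^ 2 :=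
  WithLp.prod_norm_sq_eq_of_L2 (α := K) (β := K) z

theorem continuous_fst : Continuous (fst : Complexification K → K) :=
  _root_.continuous_fst.comp (WithLp.prod_continuous_ofLp 2 K K)

theorem continuous_snd : Continuous (snd : Complexification K → K) :=
  _root_.continuous_snd.comp (WithLp.prod_continuous_ofLp 2 K K)

end

variable {K : Type*} [NormedAddCommGroup K] [InnerProductSpace ℝ K]

/-- `(s + i t) (h, g) = (s h - t g, s g + t h)`. -/
instance : SMul ℂ (Complexification K) :=
  ⟨fun c z => mk (c.re • z.fst - c.im • z.snd) (c.re • z.snd + c.im • z.fst)⟩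

@[simp] theorem fst_smul (c : ℂ) (z : Complexification K) :
    (c • z).fst = c.re • z.fst - c.im • z.snd := rfl
@[simp] theorem snd_smul (c : ℂ) (z : Complexification K) :
    (c • z).snd = c.re • z.snd + c.im • z.fst := rfl

instance : Module ℂ (Complexification K) where
  one_smul z := by ext <;> simp
  mul_smul c d z := by
    ext <;> simp only [fst_smul, snd_smul, Complex.mul_re, Complex.mul_im] <;> module
  smul_zero c := by ext <;> simp
  smul_add c z w := by
    ext <;> simp only [fst_smul, snd_smul, fst_add, snd_add] <;> module
  add_smul c d z := by
    ext <;> simp only [fst_smul, snd_smul, fst_add, snd_add, Complex.add_re, Complex.add_im] <;>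
      module
  zero_smul z := by ext <;> simp

theorem norm_smul_sq (c : ℂ) (z : Complexification K) : ‖c • z‖ ^ 2 = (‖c‖ * ‖z‖) ^ 2 := by
  rw [mul_pow, norm_sq_eq, norm_sq_eq, ← Complex.normSq_eq_norm_sq, Complex.normSq_apply,
    fst_smul, snd_smul, norm_sub_sq_real, norm_add_sq_real]
  simp only [norm_smul, inner_smul_left, inner_smul_right, mul_pow, Real.norm_eq_abs, sq_abs,
    conj_trivial]
  rw [real_inner_comm z.fst z.snd]
  ring

/-- The complex inner product, linear in the second variable as usual in Mathlib. -/
instance : InnerProductSpace ℂ (Complexification K) where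
  norm_smul_le c z :=
    (abs_le_of_sq_le_sq' (norm_smul_sq c z).le (by positivity)).2
  inner z w := ((⟪w.fst, z.fst⟫_ℝ + ⟪w.snd, z.snd⟫_ℝ : ℝ) : ℂ) +
    I * ((⟪w.snd, z.fst⟫_ℝ - ⟪w.fst, z.snd⟫_ℝ : ℝ) : ℂ)
  norm_sq_eq_re_inner z := by
    rw [norm_sq_eq]
    simp [-Complex.ofReal_pow]
  conj_inner_symm z w := by
    apply Complex.ext
    · simp [real_inner_comm]
    · simp [real_inner_comm]
  add_left z w u := by
    apply Complex.ext
    · simp [inner_add_right]; ring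
    · simp [inner_add_right]; ring
  smul_left z w c := by
    apply Complex.ext
    · simp [inner_add_right, inner_sub_right, inner_smul_right]; ring
    · simp [inner_add_right, inner_sub_right, inner_smul_right]; ring

/-- The operator `[[A, -B], [B, A]]` on the complexification. -/
def blockOperator (A B : K →L[ℝ] K) : Complexification K →L[ℂ] Complexification K where
  toFun z := mk (A z.fst - B z.snd) (B z.fst + A z.snd)
  map_add' z w := by ext <;> simp <;> abel
  map_smul' c z := by
    ext <;> simp only [fst_mk, snd_mk, fst_smul, snd_smul, map_add, map_sub, map_smul,
      RingHom.id_apply] <;> module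
  cont := by
    have h1 := continuous_fst (K := K)
    have h2 := continuous_snd (K := K)
    exact (WithLp.prod_continuous_toLp 2 K K).comp
      (((A.continuous.comp h1).sub (B.continuous.comp h2)).prodMk
        ((B.continuous.comp h1).add (A.continuous.comp h2)))

end Complexification

/-! ### The isomorphism `X : H → 𝔆(H_ℝ)` and the models of operators -/

namespace SpectralMeasure

variable {H : Type*} [NormedAddCommGroup H] [InnerProductSpace ℂ H] [CompleteSpace H]

/-- The isometry `X⁻¹ : 𝔆(H_ℝ) → H`, `(h, g) ↦ h + i g`. -/
def ofComplexification (E : SpectralMeasure H) {ι : Type*} {x : ι → H}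
    (hx : E.IsCyclicDecomposition x) : Complexification (E.realForm x) →ₗᵢ[ℂ] H where
  toFun z := (z.fst : H) + I • (z.snd : H)
  map_add' z w := by
    simp only [Complexification.fst_add, Complexification.snd_add, Submodule.coe_add]
    module
  map_smul' c z := by
    simp only [Complexification.fst_smul, Complexification.snd_smul, Submodule.coe_add,
      Submodule.coe_sub, Submodule.coe_smul, RingHom.id_apply, ← Complex.coe_smul]
    nth_rw 5 [← Complex.re_add_im c]
    match_scalars
    · simp [mul_comm I]
    · linear_combination (-(c.im : ℂ)) * Complex.I_mul_I
  norm_map' z := by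
    have h : ‖(z.fst : H) + I • (z.snd : H)‖ ^ 2 = ‖z‖ ^ 2 := by
      rw [Complexification.norm_sq_eq, norm_add_sq (𝕜 := ℂ), inner_smul_right]
      simp [norm_smul, E.inner_im_eq_zero hx z.fst.2 z.snd.2]
    exact (sq_eq_sq₀ (norm_nonneg _) (norm_nonneg _)).1 h

theorem ofComplexification_surjective (E : SpectralMeasure H) {ι : Type*} {x : ι → H}
    (hx : E.IsCyclicDecomposition x) : Function.Surjective (E.ofComplexification hx) := by
  have hc : IsClosed (LinearMap.range (E.ofComplexification hx).toLinearMap : Set H) := by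
    rw [LinearMap.coe_range]
    exact (E.ofComplexification hx).isometry.isClosedEmbedding.isClosed_range
  have h : (⊤ : Submodule ℂ H) ≤ LinearMap.range (E.ofComplexification hx).toLinearMap := by
    rw [← hx.total]
    refine Submodule.topologicalClosure_minimal _ (iSup_le fun k => ?_) hc
    refine Submodule.topologicalClosure_minimal _ (Submodule.span_le.2 ?_) hc
    rintro _ ⟨Ω, hΩ, rfl⟩
    refine ⟨Complexification.mk ⟨_, E.proj_mem_realForm x k hΩ⟩ 0, ?_⟩
    simp [ofComplexification]
  intro v
  exact h (Submodule.mem_top (x := v))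

/-- The isometric isomorphism `X : H → 𝔆(H_ℝ)`, `X (h + i g) = (h, g)` for `h, g ∈ H_ℝ`. -/
def toComplexification (E : SpectralMeasure H) {ι : Type*} {x : ι → H}
    (hx : E.IsCyclicDecomposition x) : H ≃ₗᵢ[ℂ] Complexification (E.realForm x) :=
  (LinearIsometryEquiv.ofSurjective (E.ofComplexification hx)
    (E.ofComplexification_surjective hx)).symm

theorem toComplexification_add_I_smul (E : SpectralMeasure H) {ι : Type*} {x : ι → H}
    (hx : E.IsCyclicDecomposition x) (h g : E.realForm x) :
    E.toComplexification hx ((h : H) + I • (g : H)) = Complexification.mk h g :=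
  (LinearIsometryEquiv.ofSurjective (E.ofComplexification hx)
    (E.ofComplexification_surjective hx)).symm_apply_apply (Complexification.mk h g)

/-- The model `X A X⁻¹` on `𝔆(H_ℝ)` of an operator `A` on `H`. -/
def model (E : SpectralMeasure H) {ι : Type*} {x : ι → H} (hx : E.IsCyclicDecomposition x)
    (A : H →L[ℂ] H) : Complexification (E.realForm x) →L[ℂ] Complexification (E.realForm x) :=
  (E.toComplexification hx).toContinuousLinearEquiv.toContinuousLinearMap ∘L A ∘L
    (E.toComplexification hx).symm.toContinuousLinearEquiv.toContinuousLinearMap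

end SpectralMeasure

/-- The conditions on a pair of real linear operators `A`, `B` on a real Hilbert space: both are
self-adjoint, they commute, and `A² + B² = I`. -/
def IsSelfAdjointCirclePair {K : Type*} [NormedAddCommGroup K] [InnerProductSpace ℝ K]
    [CompleteSpace K] (A B : K →L[ℝ] K) : Prop :=
  ContinuousLinearMap.adjoint A = A ∧ ContinuousLinearMap.adjoint B = B ∧
    A ∘L B = B ∘L A ∧ A ∘L A + B ∘L B = ContinuousLinearMap.id ℝ K

end

/-! Write J for the canonical conjugation (h, g) ↦ (h, -g) on the complexification and Û for the
model of U. The heart of the matter is the symmetry J Û J = Û* (`adjoint_model_eq`). Each E(Ω) maps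
the real form into itself, so its model commutes with the isometry J; hence y and J y have the same
scalar spectral measure, and the quadratic forms of Û* and J Û J agree.

Given this, C ↦ W = C J sends conjugations to complex linear unitaries with W* = J C = J W J, and C
Û C = W (J Û J) W* = W Û* W*. Conversely W J is a conjugation whenever W* = J W J and W W* = I.
Every complex linear operator on the complexification is a block matrix [[A, -B], [B, A]], and for
it these two identities say exactly that A and B are self-adjoint, commute and satisfy A² + B² = I
(`isSelfAdjointCirclePair_iff`). Conjugating by X moves all this between H and the model.

The existence claims are separate. The spectral measure comes from the continuous functional
calculus: Riesz measures μ_h represent f ↦ ⟨h, f(U)h⟩, and f ↦ f(U)h extends to L²(μ_h), hence to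
indicators. The cyclic decomposition comes from Zorn's lemma, with separability giving countability.
-/

noncomputable section

/-! ### The continuous functional calculus on the circle and its scalar measures -/

section CircleCalculus

variable {H : Type*} [NormedAddCommGroup H] [InnerProductSpace ℂ H] [CompleteSpace H]

/-- The coordinate function of the unit circle. -/
def circleCoord : C(Circle, ℂ) := ⟨fun ξ => (ξ : ℂ), by fun_prop⟩

/-- The continuous functional calculus of a unitary operator, on functions on the circle. -/
theorem exists_circle_calculus {U : H →L[ℂ] H} (hU : U ∈ unitary (H →L[ℂ] H)) :
    ∃ φ : C(Circle, ℂ) →⋆ₐ[ℂ] (H →L[ℂ] H), φ circleCoord = U := by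
  have hn : IsStarNormal U := isStarNormal_of_mem_unitary hU
  -- The spectrum lies on the circle, so restricting functions to it replaces the spectrum by one
  -- fixed compact space.
  let ι : C(spectrum ℂ U, Circle) :=
    ⟨fun z => ⟨z, spectrum.subset_circle_of_unitary hU z.2⟩, by
      exact Continuous.subtype_mk continuous_subtype_val _⟩
  refine ⟨(cfcHom (R := ℂ) hn).comp (ContinuousMap.compStarAlgHom' ℂ ℂ ι), ?_⟩
  exact cfcHom_id (R := ℂ) hn

variable (φ : C(Circle, ℂ) →⋆ₐ[ℂ] (H →L[ℂ] H))

theorem inner_calculus (f : C(Circle, ℂ)) (h g : H) :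
    ⟪φ f h, g⟫_ℂ = ⟪h, φ (star f) g⟫_ℂ := by
  rw [map_star, ContinuousLinearMap.star_eq_adjoint, ContinuousLinearMap.adjoint_inner_right]

/-- The real function `f` as a complex function. -/
def circleOfReal (f : C(Circle, ℝ)) : C(Circle, ℂ) := ⟨fun ξ => (f ξ : ℂ), by fun_prop⟩

theorem star_circleOfReal (f : C(Circle, ℝ)) : star (circleOfReal f) = circleOfReal f := by
  ext ξ; simp [circleOfReal]

theorem inner_calculus_ofReal_im (f : C(Circle, ℝ)) (h : H) :
    (⟪h, φ (circleOfReal f) h⟫_ℂ).im = 0 := by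
  have h1 := inner_calculus φ (circleOfReal f) h h
  rw [star_circleOfReal, ← inner_conj_symm] at h1
  exact Complex.conj_eq_iff_im.1 h1

/-- With g = √f the form equals ‖g(U)h‖². Positivity is what the Riesz representation theorem
requires. -/
theorem inner_calculus_ofReal_nonneg {f : C(Circle, ℝ)} (hf : ∀ ξ, 0 ≤ f ξ) (h : H) :
    0 ≤ (⟪h, φ (circleOfReal f) h⟫_ℂ).re := by
  let g : C(Circle, ℝ) := ⟨fun ξ => Real.sqrt (f ξ), by fun_prop⟩
  have h1 : circleOfReal f = star (circleOfReal g) * circleOfReal g := by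
    rw [star_circleOfReal]
    ext ξ
    simp only [circleOfReal, g, ContinuousMap.coe_mk, ContinuousMap.mul_apply]
    rw [← Complex.ofReal_mul, Real.mul_self_sqrt (hf ξ)]
  rw [h1, map_mul, mul_apply_eq_comp, ← inner_calculus]
  exact inner_self_nonneg (𝕜 := ℂ)

/-- The functional `f ↦ ⟨h, f(U) h⟩` on real continuous functions. -/
def calculusFunctional (h : H) : CompactlySupportedContinuousMap Circle ℝ →ₚ[ℝ] ℝ :=
  PositiveLinearMap.mk₀
    { toFun := fun f => (⟪h, φ (circleOfReal f.toContinuousMap) h⟫_ℂ).re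
      map_add' := fun f g => by
        have : circleOfReal (f + g).toContinuousMap =
            circleOfReal f.toContinuousMap + circleOfReal g.toContinuousMap := by
          ext ξ; simp [circleOfReal]
        rw [this, map_add]; simp
      map_smul' := fun r f => by
        have : circleOfReal (r • f).toContinuousMap =
            (r : ℂ) • circleOfReal f.toContinuousMap := by
          ext ξ; simp [circleOfReal]
        rw [this, map_smul]; simp }
    (fun f hf => inner_calculus_ofReal_nonneg φ (fun ξ => hf ξ) h)

/-- Riesz–Markov–Kakutani gives the formula for real f; real and imaginary parts give the complex
case. -/
theorem exists_calculus_measure (h : H) :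
    ∃ μ : Measure Circle, IsFiniteMeasure μ ∧
      ∀ f : C(Circle, ℂ), ⟪h, φ f h⟫_ℂ = ∫ ξ, f ξ ∂μ := by
  let μ := RealRMK.rieszMeasure (calculusFunctional φ h)
  have hfin : IsFiniteMeasure μ := inferInstance
  refine ⟨μ, hfin, fun f => ?_⟩
  have key : ∀ f : C(Circle, ℝ), ⟪h, φ (circleOfReal f) h⟫_ℂ = ((∫ ξ, f ξ ∂μ : ℝ) : ℂ) := by
    intro f
    have h1 := RealRMK.integral_rieszMeasure (calculusFunctional φ h)
      (CompactlySupportedContinuousMap.continuousMapEquiv f)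
    have h2 : ∫ ξ, f ξ ∂μ = (⟪h, φ (circleOfReal f) h⟫_ℂ).re := h1
    rw [h2]
    exact Complex.ext (by simp) (by simp [inner_calculus_ofReal_im])
  let a : C(Circle, ℝ) := ⟨fun ξ => (f ξ).re, by fun_prop⟩
  let b : C(Circle, ℝ) := ⟨fun ξ => (f ξ).im, by fun_prop⟩
  have hab : f = circleOfReal a + I • circleOfReal b := by
    ext ξ
    simp [circleOfReal, a, b, mul_comm I, Complex.re_add_im]
  have hi : Integrable (fun ξ => f ξ) μ :=
    f.continuous.integrable_of_hasCompactSupport (HasCompactSupport.of_compactSpace _)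
  have hl : ⟪h, φ f h⟫_ℂ =
      ⟪h, φ (circleOfReal a) h⟫_ℂ + I * ⟪h, φ (circleOfReal b) h⟫_ℂ := by
    conv_lhs => rw [hab, map_add, map_smul]
    simp
  rw [hl, key, key, ← integral_re_add_im hi, mul_comm I]
  rfl

/-- The measure `μ` with `⟨h, f(U) h⟩ = ∫ f dμ`. -/
def calculusMeasure (h : H) : Measure Circle := (exists_calculus_measure φ h).choose

instance (h : H) : IsFiniteMeasure (calculusMeasure φ h) :=
  (exists_calculus_measure φ h).choose_spec.1

theorem inner_calculus_eq_integral (h : H) (f : C(Circle, ℂ)) :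
    ⟪h, φ f h⟫_ℂ = ∫ ξ, f ξ ∂(calculusMeasure φ h) :=
  (exists_calculus_measure φ h).choose_spec.2 f

/-! ### Extension of the calculus from continuous functions to indicators -/

/-- Multiplicativity gives ‖f(U)h‖² = ⟨h, (f̄f)(U)h⟩ = ∫ |f|² dμ_h. So f ↦ f(U)h extends from the
dense subspace of continuous functions to all of L²(μ_h). -/
theorem norm_calculus_eq_norm_toLp (h : H) (f : C(Circle, ℂ)) :
    ‖φ f h‖ = ‖ContinuousMap.toLp 2 (calculusMeasure φ h) ℂ f‖ := by
  have h1 : ⟪φ f h, φ f h⟫_ℂ = ⟪ContinuousMap.toLp 2 (calculusMeasure φ h) ℂ f,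
      ContinuousMap.toLp 2 (calculusMeasure φ h) ℂ f⟫_ℂ := by
    rw [inner_calculus, ← mul_apply_eq_comp, ← map_mul, inner_calculus_eq_integral,
      ContinuousMap.inner_toLp]
    exact integral_congr_ae (.of_forall fun ξ => mul_comm _ _)
  rw [inner_self_eq_norm_sq_to_K, inner_self_eq_norm_sq_to_K] at h1
  exact (sq_eq_sq₀ (norm_nonneg _) (norm_nonneg _)).1 (by exact_mod_cast h1)

/-- The evaluation `f ↦ f(U) h`, as a linear map. -/
def calculusEval (h : H) : C(Circle, ℂ) →ₗ[ℂ] H where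
  toFun f := φ f h
  map_add' f g := by simp
  map_smul' c f := by simp

/-- The isometry `L²(μ_h) → H` that extends `f ↦ f(U) h`. -/
def calculusIsometry (h : H) : Lp ℂ 2 (calculusMeasure φ h) →ₗᵢ[ℂ] H where
  toLinearMap := ((calculusEval φ h).extendOfNorm
    (ContinuousMap.toLp 2 (calculusMeasure φ h) ℂ).toLinearMap).toLinearMap
  norm_map' v := by
    have hd : DenseRange (ContinuousMap.toLp (E := ℂ) 2 (calculusMeasure φ h) ℂ).toLinearMap :=
      ContinuousMap.toLp_denseRange ℂ (calculusMeasure φ h) ℂ (by simp)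
    refine hd.induction_on v (isClosed_eq (by fun_prop) (by fun_prop)) fun f => ?_
    have := LinearMap.extendOfNorm_eq (f := calculusEval φ h) hd
      ⟨1, fun f => by rw [one_mul]; exact (norm_calculus_eq_norm_toLp φ h f).le⟩ f
    erw [this]
    exact norm_calculus_eq_norm_toLp φ h f

theorem calculusIsometry_toLp (h : H) (f : C(Circle, ℂ)) :
    calculusIsometry φ h (ContinuousMap.toLp 2 (calculusMeasure φ h) ℂ f) = φ f h :=
  LinearMap.extendOfNorm_eq (f := calculusEval φ h)
    (e := (ContinuousMap.toLp 2 (calculusMeasure φ h) ℂ).toLinearMap)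
    (ContinuousMap.toLp_denseRange ℂ (calculusMeasure φ h) ℂ (by simp))
    ⟨1, fun f => by rw [one_mul]; exact (norm_calculus_eq_norm_toLp φ h f).le⟩ f

/-- The vector `1_Ω(U) h`. -/
def calculusIndicator {Ω : Set Circle} (hΩ : MeasurableSet Ω) (h : H) : H :=
  calculusIsometry φ h (indicatorConstLp 2 hΩ (measure_ne_top _ _) (1 : ℂ))

theorem norm_calculus_sub_indicator {Ω : Set Circle} (hΩ : MeasurableSet Ω) (h : H)
    (f : C(Circle, ℝ)) :
    ‖φ (circleOfReal f) h - calculusIndicator φ hΩ h‖ =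
      (eLpNorm (Ω.indicator (fun _ => (1 : ℝ)) - ⇑f) 2 (calculusMeasure φ h)).toReal := by
  rw [calculusIndicator, ← calculusIsometry_toLp, ← map_sub, LinearIsometry.norm_map,
    ← norm_neg, neg_sub, Lp.norm_def]
  congr 1
  refine eLpNorm_congr_norm_ae ?_
  filter_upwards [Lp.coeFn_sub (indicatorConstLp 2 hΩ (measure_ne_top _ _) (1 : ℂ))
      (ContinuousMap.toLp 2 (calculusMeasure φ h) ℂ (circleOfReal f)),
    indicatorConstLp_coeFn (p := 2) (hs := hΩ) (hμs := measure_ne_top (calculusMeasure φ h) _)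
      (c := (1 : ℂ)),
    ContinuousMap.coeFn_toLp (p := 2) (𝕜 := ℂ) (calculusMeasure φ h) (circleOfReal f)]
    with ξ h1 h2 h3
  rw [h1, Pi.sub_apply, Pi.sub_apply, h2, h3, ← Complex.norm_real]
  by_cases hξ : ξ ∈ Ω <;> simp [hξ, circleOfReal]

/-- Each vector has its own L² space, so linearity of h ↦ 1_Ω(U)h is not automatic. Approximating
1_Ω in L² of the sum of three scalar measures gives one sequence of continuous functions that works
for all three vectors; algebraic identities then pass to the limit. -/
theorem exists_tendsto_calculusIndicator {Ω : Set Circle} (hΩ : MeasurableSet Ω) (a b c : H) :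
    ∃ f : ℕ → C(Circle, ℝ), ∀ v, v = a ∨ v = b ∨ v = c →
      Filter.Tendsto (fun n => φ (circleOfReal (f n)) v) Filter.atTop
        (nhds (calculusIndicator φ hΩ v)) := by
  let μ := calculusMeasure φ a + calculusMeasure φ b + calculusMeasure φ c
  have hm : MemLp (Ω.indicator (fun _ => (1 : ℝ))) 2 μ :=
    memLp_indicator_const 2 hΩ _ (Or.inr (measure_ne_top _ _))
  have hex : ∀ n : ℕ, ∃ f : C(Circle, ℝ),
      eLpNorm (Ω.indicator (fun _ => (1 : ℝ)) - ⇑f) 2 μ ≤ ENNReal.ofReal (1 / ((n : ℝ) + 1)) := by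
    intro n
    obtain ⟨g, hg, -⟩ := hm.exists_boundedContinuous_eLpNorm_sub_le (by simp)
      (ε := ENNReal.ofReal (1 / ((n : ℝ) + 1)))
      (ENNReal.ofReal_pos.2 Nat.one_div_pos_of_nat).ne'
    exact ⟨g.toContinuousMap, hg⟩
  choose f hf using hex
  refine ⟨f, fun v hv => ?_⟩
  have hle : calculusMeasure φ v ≤ μ := by
    rcases hv with rfl | rfl | rfl
    · exact (Measure.le_add_right le_rfl).trans (Measure.le_add_right le_rfl)
    · exact (Measure.le_add_left le_rfl).trans (Measure.le_add_right le_rfl)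
    · exact Measure.le_add_left le_rfl
  rw [tendsto_iff_norm_sub_tendsto_zero]
  refine squeeze_zero (fun _ => norm_nonneg _) (fun n => ?_)
    tendsto_one_div_add_atTop_nhds_zero_nat
  rw [norm_calculus_sub_indicator]
  exact ENNReal.toReal_le_of_le_ofReal Nat.one_div_pos_of_nat.le
    ((eLpNorm_mono_measure _ hle).trans (hf n))

/-! ### The operators 1_Ω(U) are orthogonal projections -/

variable {Ω : Set Circle} (hΩ : MeasurableSet Ω)

theorem calculusIndicator_add (a b : H) : calculusIndicator φ hΩ (a + b) =
    calculusIndicator φ hΩ a + calculusIndicator φ hΩ b := by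
  obtain ⟨f, hf⟩ := exists_tendsto_calculusIndicator φ hΩ a b (a + b)
  refine tendsto_nhds_unique (hf (a + b) (by simp)) ?_
  simp_rw [map_add]
  exact (hf a (by simp)).add (hf b (by simp))

theorem calculusIndicator_smul (c : ℂ) (a : H) : calculusIndicator φ hΩ (c • a) =
    c • calculusIndicator φ hΩ a := by
  obtain ⟨f, hf⟩ := exists_tendsto_calculusIndicator φ hΩ a (c • a) a
  refine tendsto_nhds_unique (hf (c • a) (by simp)) ?_
  simp_rw [map_smul]
  exact (hf a (by simp)).const_smul c

theorem inner_calculusIndicator (a b : H) :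
    ⟪calculusIndicator φ hΩ a, b⟫_ℂ = ⟪a, calculusIndicator φ hΩ b⟫_ℂ := by
  obtain ⟨f, hf⟩ := exists_tendsto_calculusIndicator φ hΩ a b a
  refine tendsto_nhds_unique ((hf a (by simp)).inner tendsto_const_nhds) ?_
  simp_rw [inner_calculus, star_circleOfReal]
  exact tendsto_const_nhds.inner (hf b (by simp))

theorem norm_sq_calculusIndicator (a : H) :
    ‖calculusIndicator φ hΩ a‖ ^ 2 = (calculusMeasure φ a).real Ω := by
  rw [calculusIndicator, LinearIsometry.norm_map, norm_indicatorConstLp (by simp) (by simp)]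
  rw [norm_one, one_mul, ← Real.rpow_natCast, ← Real.rpow_mul measureReal_nonneg]
  simp

theorem calculusIndicator_univ (a : H) : calculusIndicator φ MeasurableSet.univ a = a := by
  have h1 : indicatorConstLp 2 MeasurableSet.univ (measure_ne_top (calculusMeasure φ a) _) (1 : ℂ)
      = ContinuousMap.toLp 2 (calculusMeasure φ a) ℂ 1 := by
    rw [indicatorConstLp_univ]; rfl
  rw [calculusIndicator, h1, calculusIsometry_toLp, map_one]; rfl

/-- In L²(μ_a) the vector a corresponds to the constant 1, so both sides are μ_a(Ω). -/
theorem inner_calculusIndicator_self (a : H) :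
    ⟪a, calculusIndicator φ hΩ a⟫_ℂ = (‖calculusIndicator φ hΩ a‖ ^ 2 : ℝ) := by
  have h1 := L2.inner_indicatorConstLp_one_indicatorConstLp_one (𝕜 := ℂ)
    (μ := calculusMeasure φ a) MeasurableSet.univ hΩ (measure_ne_top _ _) (measure_ne_top _ _)
  rw [← LinearIsometry.inner_map_map (calculusIsometry φ a), Set.univ_inter] at h1
  rw [norm_sq_calculusIndicator]
  refine Eq.trans ?_ h1
  congr 1
  exact (calculusIndicator_univ φ a).symm

theorem norm_calculusIndicator_le (a : H) : ‖calculusIndicator φ hΩ a‖ ≤ ‖a‖ := by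
  have h1 := norm_sq_calculusIndicator φ hΩ a
  have h2 := norm_sq_calculusIndicator φ MeasurableSet.univ a
  rw [calculusIndicator_univ] at h2
  exact (sq_le_sq₀ (norm_nonneg _) (norm_nonneg _)).1
    (by rw [h1, h2]; exact measureReal_mono (Set.subset_univ _))

theorem calculusIndicator_union {Ω' : Set Circle} (hΩ' : MeasurableSet Ω') (hd : Disjoint Ω Ω')
    (a : H) : calculusIndicator φ (hΩ.union hΩ') a =
      calculusIndicator φ hΩ a + calculusIndicator φ hΩ' a := by
  rw [calculusIndicator, indicatorConstLp_disjoint_union hΩ hΩ' (measure_ne_top _ _)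
    (measure_ne_top _ _) hd, map_add]
  rfl

open Classical in
/-- The operator `1_Ω(U)` (zero if `Ω` is not a Borel set). -/
def calculusProj (Ω : Set Circle) : H →L[ℂ] H :=
  if hΩ : MeasurableSet Ω then
    LinearMap.mkContinuous
      { toFun := calculusIndicator φ hΩ
        map_add' := calculusIndicator_add φ hΩ
        map_smul' := calculusIndicator_smul φ hΩ } 1
      (fun a => by rw [one_mul]; exact norm_calculusIndicator_le φ hΩ a)
  else 0

theorem calculusProj_apply (a : H) : calculusProj φ Ω a = calculusIndicator φ hΩ a := by
  rw [calculusProj, dif_pos hΩ]; rfl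

/-- For P = 1_Ω(U), self-adjointness gives ⟨P²a, a⟩ = ‖Pa‖² = ⟨Pa, a⟩, and over ℂ the quadratic form
determines the operator. -/
theorem isStarProjection_calculusProj {Ω : Set Circle} (hΩ : MeasurableSet Ω) :
    IsStarProjection (calculusProj φ Ω) := by
  have hs : IsSelfAdjoint (calculusProj φ Ω) := by
    rw [ContinuousLinearMap.isSelfAdjoint_iff_isSymmetric]
    intro a b
    simp only [ContinuousLinearMap.coe_coe, calculusProj_apply φ hΩ]
    exact inner_calculusIndicator φ hΩ a b
  refine ⟨?_, hs⟩
  rw [IsIdempotentElem]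
  apply ContinuousLinearMap.coe_injective
  rw [← ext_inner_map]
  intro a
  simp only [ContinuousLinearMap.coe_coe, mul_apply_eq_comp, calculusProj_apply φ hΩ]
  rw [inner_calculusIndicator, inner_calculusIndicator φ hΩ a a, inner_calculusIndicator_self,
    inner_self_eq_norm_sq_to_K]
  simp

end CircleCalculus

/-- Star projections whose sum is a star projection are orthogonal. -/
theorem IsStarProjection.mul_eq_zero_of_add {A : Type*} [Ring A] [Algebra ℂ A] [StarRing A]
    {p q : A} (hp : IsStarProjection p) (hq : IsStarProjection q) (h : IsStarProjection (p + q)) :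
    p * q = 0 := by
  have hp' : p * p = p := hp.isIdempotentElem
  have hq' : q * q = q := hq.isIdempotentElem
  have h' : (p + q) * (p + q) = p + q := h.isIdempotentElem
  have h1 : p * q + q * p = 0 := by
    have : p * p + q * q + (p * q + q * p) = p + q := by rw [← h']; noncomm_ring
    rwa [hp', hq', add_eq_left] at this
  -- Multiplying pq + qp = 0 by p on the left and on the right gives pq = -pqp = qp, hence 2pq = 0.
  have h2 : p * q + p * q * p = 0 := by
    have : p * (p * q + q * p) = 0 := by rw [h1, mul_zero]
    rwa [mul_add, ← mul_assoc, ← mul_assoc, hp'] at this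
  have h3 : p * q * p + q * p = 0 := by
    have : (p * q + q * p) * p = 0 := by rw [h1, zero_mul]
    rwa [add_mul, mul_assoc q, hp'] at this
  have h4 : (2 : ℂ) • (p * q) = 0 := by
    rw [two_smul]
    calc p * q + p * q = (p * q + p * q * p) - (p * q * p + q * p) + (p * q + q * p) := by abel
      _ = 0 := by rw [h1, h2, h3]; simp
  exact (smul_eq_zero_iff_right two_ne_zero).1 h4

/-! ### Existence of the spectral measure of a unitary operator -/

namespace SpectralMeasure

variable {H : Type*} [NormedAddCommGroup H] [InnerProductSpace ℂ H] [CompleteSpace H]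
variable (φ : C(Circle, ℂ) →⋆ₐ[ℂ] (H →L[ℂ] H))

theorem calculusProj_union {Ω Ω' : Set Circle} (hΩ : MeasurableSet Ω) (hΩ' : MeasurableSet Ω')
    (hd : Disjoint Ω Ω') :
    calculusProj φ (Ω ∪ Ω') = calculusProj φ Ω + calculusProj φ Ω' := by
  ext a
  rw [add_apply, calculusProj_apply φ hΩ, calculusProj_apply φ hΩ',
    calculusProj_apply φ (hΩ.union hΩ'), calculusIndicator_union φ hΩ hΩ' hd]

theorem calculusProj_mul_of_disjoint {Ω Ω' : Set Circle} (hΩ : MeasurableSet Ω)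
    (hΩ' : MeasurableSet Ω') (hd : Disjoint Ω Ω') :
    calculusProj φ Ω * calculusProj φ Ω' = 0 := by
  refine (isStarProjection_calculusProj φ hΩ).mul_eq_zero_of_add
    (isStarProjection_calculusProj φ hΩ') ?_
  rw [← calculusProj_union φ hΩ hΩ' hd]
  exact isStarProjection_calculusProj φ (hΩ.union hΩ')

/-- Split Ω and Ω' along their intersection. Disjoint sets give orthogonal projections, so only the
square of the common part survives in the product. -/
theorem calculusProj_inter {Ω Ω' : Set Circle} (hΩ : MeasurableSet Ω) (hΩ' : MeasurableSet Ω') :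
    calculusProj φ (Ω ∩ Ω') = calculusProj φ Ω * calculusProj φ Ω' := by
  have hi := hΩ.inter hΩ'
  have h1 : calculusProj φ Ω = calculusProj φ (Ω \ Ω') + calculusProj φ (Ω ∩ Ω') := by
    rw [← calculusProj_union φ (hΩ.diff hΩ') hi Set.disjoint_sdiff_inter, Set.sdiff_union_inter]
  have h2 : calculusProj φ Ω' = calculusProj φ (Ω' \ Ω) + calculusProj φ (Ω ∩ Ω') := by
    rw [Set.inter_comm, ← calculusProj_union φ (hΩ'.diff hΩ) (hΩ'.inter hΩ)
      Set.disjoint_sdiff_inter, Set.sdiff_union_inter]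
  rw [h1, h2, add_mul, mul_add, mul_add,
    calculusProj_mul_of_disjoint φ (hΩ.diff hΩ') (hΩ'.diff hΩ)
      (Set.disjoint_left.2 fun _ h h' => h.2 h'.1),
    calculusProj_mul_of_disjoint φ (hΩ.diff hΩ') hi
      (Set.disjoint_left.2 fun _ h h' => h.2 h'.2),
    calculusProj_mul_of_disjoint φ hi (hΩ'.diff hΩ)
      (Set.disjoint_left.2 fun _ h h' => h'.2 h.1),
    (isStarProjection_calculusProj φ hi).isIdempotentElem]
  simp

theorem calculusProj_empty : calculusProj φ ∅ = 0 := by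
  have h := calculusProj_union φ MeasurableSet.empty MeasurableSet.empty (disjoint_bot_left)
  rwa [Set.union_self, left_eq_add] at h

theorem norm_sq_calculusProj {Ω : Set Circle} (hΩ : MeasurableSet Ω) (a : H) :
    ‖calculusProj φ Ω a‖ ^ 2 = (calculusMeasure φ a).real Ω := by
  rw [calculusProj_apply φ hΩ, norm_sq_calculusIndicator]

/-- By finite additivity the error of a partial sum is minus the projection of the remaining set.
Its squared norm is the μ_a-measure of that set, which tends to 0 by countable additivity of μ_a. -/
theorem hasSum_calculusProj (Ω : ℕ → Set Circle) (hΩ : ∀ n, MeasurableSet (Ω n))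
    (hd : Pairwise (Function.onFun Disjoint Ω)) (a : H) :
    HasSum (fun n => calculusProj φ (Ω n) a) (calculusProj φ (⋃ n, Ω n) a) := by
  have hfin : ∀ s : Finset ℕ, ∑ n ∈ s, calculusProj φ (Ω n) a =
      calculusProj φ (⋃ n ∈ s, Ω n) a := by
    intro s
    induction s using Finset.induction_on with
    | empty => simp [calculusProj_empty]
    | insert n s hn ih =>
      rw [Finset.sum_insert hn, ih, Finset.set_biUnion_insert,
        calculusProj_union φ (hΩ n) (Finset.measurableSet_biUnion s fun i _ => hΩ i), add_apply]
      rw [Set.disjoint_iUnion₂_right]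
      exact fun i hi => hd (by rintro rfl; exact hn hi)
  have hU : MeasurableSet (⋃ n, Ω n) := MeasurableSet.iUnion hΩ
  have hμ : HasSum (fun n => (calculusMeasure φ a).real (Ω n))
      ((calculusMeasure φ a).real (⋃ n, Ω n)) := by
    rw [measureReal_def, measure_iUnion hd hΩ, ENNReal.tsum_toReal_eq fun n => measure_ne_top _ _]
    refine ENNReal.hasSum_toReal ?_
    rw [← measure_iUnion hd hΩ]
    exact measure_ne_top _ _
  have hdiff : ∀ s : Finset ℕ, ‖∑ n ∈ s, calculusProj φ (Ω n) a - calculusProj φ (⋃ n, Ω n) a‖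
      = Real.sqrt ((calculusMeasure φ a).real (⋃ n, Ω n) -
        ∑ n ∈ s, (calculusMeasure φ a).real (Ω n)) := by
    intro s
    have hs : MeasurableSet (⋃ n ∈ s, Ω n) := Finset.measurableSet_biUnion s fun i _ => hΩ i
    have hsub : (⋃ n ∈ s, Ω n) ⊆ ⋃ n, Ω n := Set.iUnion₂_subset_iUnion _ _
    have h1 := calculusProj_union φ hs (hU.diff hs) Set.disjoint_sdiff_right
    rw [Set.union_sdiff_cancel hsub] at h1
    have h2 : ∑ n ∈ s, calculusProj φ (Ω n) a - calculusProj φ (⋃ n, Ω n) a =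
        -calculusProj φ ((⋃ n, Ω n) \ ⋃ n ∈ s, Ω n) a := by
      rw [hfin, h1, add_apply]; abel
    rw [h2, norm_neg, ← Real.sqrt_sq (norm_nonneg _), norm_sq_calculusProj φ (hU.diff hs),
      measureReal_sdiff hsub hs, measureReal_biUnion_finset (fun i _ j _ hij => hd hij)
        (fun i _ => hΩ i)]
  rw [HasSum, tendsto_iff_norm_sub_tendsto_zero]
  simp_rw [hdiff]
  have := (Real.continuous_sqrt.tendsto _).comp
    (hμ.const_sub ((calculusMeasure φ a).real (⋃ n, Ω n)))
  simpa only [sub_self, Real.sqrt_zero, Function.comp_def] using this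

/-- The spectral measure of a functional calculus on the circle. -/
def ofCalculus : SpectralMeasure H where
  proj := calculusProj φ
  isStarProjection _ hΩ := isStarProjection_calculusProj φ hΩ
  empty := calculusProj_empty φ
  univ := by
    ext a
    rw [calculusProj_apply φ MeasurableSet.univ, calculusIndicator_univ]
    rfl
  inter _ _ h₁ h₂ := calculusProj_inter φ h₁ h₂
  iUnion := hasSum_calculusProj φ

theorem scalarMeasure_apply (E : SpectralMeasure H) (h : H) {Ω : Set Circle}
    (hΩ : MeasurableSet Ω) : E.scalarMeasure h Ω = ENNReal.ofReal (‖E.proj Ω h‖ ^ 2) :=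
  Measure.ofMeasurable_apply Ω hΩ

/-- Turns the Riesz formula for the coordinate function into U = ∫ ξ dE(ξ). -/
theorem scalarMeasure_ofCalculus (h : H) :
    (ofCalculus φ).scalarMeasure h = calculusMeasure φ h := by
  ext Ω hΩ
  rw [scalarMeasure_apply _ _ hΩ]
  change ENNReal.ofReal (‖calculusProj φ Ω h‖ ^ 2) = _
  rw [norm_sq_calculusProj φ hΩ, ofReal_measureReal]

/-- The spectral theorem for unitary operators. -/
theorem exists_isSpectralMeasureOf {U : H →L[ℂ] H} (hU : U ∈ unitary (H →L[ℂ] H)) :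
    ∃ E : SpectralMeasure H, E.IsSpectralMeasureOf U := by
  obtain ⟨φ, hφ⟩ := exists_circle_calculus hU
  refine ⟨ofCalculus φ, fun h => ?_⟩
  rw [scalarMeasure_ofCalculus, ← hφ, inner_calculus_eq_integral]
  rfl

end SpectralMeasure

/-! ### Existence of a cyclic decomposition -/

namespace SpectralMeasure

variable {H : Type*} [NormedAddCommGroup H] [InnerProductSpace ℂ H] [CompleteSpace H]
variable (E : SpectralMeasure H)

theorem inner_proj_left {Ω : Set Circle} (hΩ : MeasurableSet Ω) (v w : H) :
    ⟪E.proj Ω v, w⟫_ℂ = ⟪v, E.proj Ω w⟫_ℂ := by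
  simpa [E.univ] using E.inner_proj hΩ MeasurableSet.univ v w

theorem self_mem_cyclicSubspace (v : H) : v ∈ E.cyclicSubspace v := by
  simpa [E.univ] using E.proj_mem_cyclicSubspace v MeasurableSet.univ

theorem cyclicSubspace_le {K : Submodule ℂ H} (hK : IsClosed (K : Set H)) {v : H}
    (h : ∀ Ω, MeasurableSet Ω → E.proj Ω v ∈ K) : E.cyclicSubspace v ≤ K := by
  refine Submodule.topologicalClosure_minimal _ (Submodule.span_le.2 ?_) hK
  rintro _ ⟨Ω, hΩ, rfl⟩
  exact h Ω hΩ

/-- Since ⟨E(Ω)v, E(Ω')w⟩ = ⟨E(Ω ∩ Ω')v, w⟩, testing against w alone suffices. -/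
theorem cyclicSubspace_isOrtho {v w : H}
    (h : ∀ Ω, MeasurableSet Ω → ⟪E.proj Ω v, w⟫_ℂ = 0) :
    E.cyclicSubspace v ⟂ E.cyclicSubspace w := by
  rw [Submodule.isOrtho_iff_le]
  refine E.cyclicSubspace_le (Submodule.isClosed_orthogonal _) fun Ω hΩ => ?_
  have : E.cyclicSubspace w ≤ (Submodule.span ℂ {E.proj Ω v})ᗮ := by
    refine E.cyclicSubspace_le (Submodule.isClosed_orthogonal _) fun Ω' hΩ' => ?_
    rw [Submodule.mem_orthogonal_singleton_iff_inner_right, E.inner_proj hΩ hΩ',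
      ← E.inner_proj_left (hΩ.inter hΩ')]
    exact h _ (hΩ.inter hΩ')
  rw [Submodule.mem_orthogonal]
  intro u hu
  rw [← inner_conj_symm, (Submodule.mem_orthogonal_singleton_iff_inner_right.1 (this hu)), map_zero]

/-- A set of unit vectors that generate pairwise orthogonal cyclic subspaces. -/
def IsCyclicSystem (S : Set H) : Prop :=
  (∀ v ∈ S, ‖v‖ = 1) ∧ S.Pairwise fun v w => E.cyclicSubspace v ⟂ E.cyclicSubspace w

theorem exists_maximal_isCyclicSystem : ∃ S, Maximal E.IsCyclicSystem S := by
  refine zorn_subset _ fun c hc hchain => ⟨⋃₀ c, ⟨?_, ?_⟩, fun s hs => Set.subset_sUnion_of_mem hs⟩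
  · rintro v ⟨s, hs, hv⟩
    exact (hc hs).1 v hv
  · exact (Set.pairwise_sUnion hchain.directedOn).2 fun s hs => (hc hs).2

variable {E} {S : Set H}

theorem IsCyclicSystem.orthonormal (hS : E.IsCyclicSystem S) :
    Orthonormal ℂ ((↑) : S → H) :=
  ⟨fun v => hS.1 v v.2, fun v w hvw => Submodule.isOrtho_iff_inner_eq.1
    (hS.2 v.2 w.2 (Subtype.coe_injective.ne hvw)) _ (E.self_mem_cyclicSubspace v) _
    (E.self_mem_cyclicSubspace w)⟩

/-- Distinct members are orthonormal, so they lie at distance √2 and their balls of radius 1/2 are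
disjoint. -/
theorem IsCyclicSystem.countable [TopologicalSpace.SeparableSpace H] (hS : E.IsCyclicSystem S) :
    S.Countable := by
  refine Set.PairwiseDisjoint.countable_of_isOpen (s := fun v => Metric.ball v (1 / 2)) ?_
    (fun v _ => Metric.isOpen_ball) (fun v _ => ⟨v, Metric.mem_ball_self (by norm_num)⟩)
  intro v hv w hw hvw
  refine Metric.ball_disjoint_ball ?_
  have h1 : ⟪v, w⟫_ℂ = 0 := Submodule.isOrtho_iff_inner_eq.1 (hS.2 hv hw hvw) _
    (E.self_mem_cyclicSubspace v) _ (E.self_mem_cyclicSubspace w)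
  have h2 := norm_sub_sq (𝕜 := ℂ) v w
  rw [h1, hS.1 v hv, hS.1 w hw] at h2
  rw [dist_eq_norm]
  norm_num at h2 ⊢
  nlinarith [norm_nonneg (v - w)]

/-- A unit vector w orthogonal to every cyclic subspace generates one orthogonal to them all.
Maximality then puts w in S, so w is orthogonal to itself. -/
theorem total_of_maximal (hS : Maximal E.IsCyclicSystem S) :
    (⨆ v : S, E.cyclicSubspace v).topologicalClosure = ⊤ := by
  set K := (⨆ v : S, E.cyclicSubspace v).topologicalClosure with hK
  have hle : ∀ v ∈ S, E.cyclicSubspace v ≤ K := fun v hv =>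
    (le_iSup (fun v : S => E.cyclicSubspace v) ⟨v, hv⟩).trans (Submodule.le_topologicalClosure _)
  have : CompleteSpace K := Submodule.topologicalClosure.completeSpace _
  rw [← Submodule.orthogonal_eq_bot_iff, Submodule.eq_bot_iff]
  by_contra! hne
  obtain ⟨u, hu, hu0⟩ := hne
  let w : H := ((‖u‖⁻¹ : ℝ) : ℂ) • u
  have hw : w ∈ Kᗮ := Submodule.smul_mem _ _ hu
  have hw1 : ‖w‖ = 1 := by
    simp [w, norm_smul, hu0]
  have hor : ∀ v ∈ S, E.cyclicSubspace v ⟂ E.cyclicSubspace w := fun v hv =>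
    E.cyclicSubspace_isOrtho fun Ω hΩ =>
      Submodule.inner_right_of_mem_orthogonal (hle v hv (E.proj_mem_cyclicSubspace v hΩ)) hw
  have hins : E.IsCyclicSystem (insert w S) := by
    refine ⟨Set.forall_mem_insert.2 ⟨hw1, hS.prop.1⟩, ?_⟩
    exact Set.pairwise_insert.2 ⟨hS.prop.2, fun v hv _ => ⟨(hor v hv).symm, hor v hv⟩⟩
  have hwS : w ∈ S := hS.le_of_ge hins (Set.subset_insert w S) (Set.mem_insert w S)
  have h0 : ⟪w, w⟫_ℂ = 0 :=
    Submodule.inner_right_of_mem_orthogonal (hle w hwS (E.self_mem_cyclicSubspace w)) hw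
  rw [inner_self_eq_zero] at h0
  simp [h0] at hw1

theorem exists_isCyclicDecomposition [TopologicalSpace.SeparableSpace H]
    (E : SpectralMeasure H) : ∃ (N : Set ℕ) (x : N → H), E.IsCyclicDecomposition x := by
  obtain ⟨S, hS⟩ := E.exists_maximal_isCyclicSystem
  have : Countable S := hS.prop.countable
  obtain ⟨f, hf⟩ := exists_injective_nat S
  let e : Set.range f ≃ S := (Equiv.ofInjective f hf).symm
  refine ⟨Set.range f, fun n => e n, hS.prop.orthonormal.comp e e.injective, ?_, ?_⟩
  · intro j k hjk
    exact hS.prop.2 (e j).2 (e k).2 (Subtype.coe_injective.ne (e.injective.ne hjk))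
  · rw [e.iSup_comp (g := fun v : S => E.cyclicSubspace v)]
    exact total_of_maximal hS

end SpectralMeasure

/-! ### Block operators and conjugations on a complexification -/

namespace Complexification

section

variable {K : Type*} [NormedAddCommGroup K]

/-- The canonical conjugation `(h, g) ↦ (h, -g)`. -/
def conjMap (z : Complexification K) : Complexification K := mk z.fst (-z.snd)

@[simp] theorem fst_conjMap (z : Complexification K) : (conjMap z).fst = z.fst := rfl
@[simp] theorem snd_conjMap (z : Complexification K) : (conjMap z).snd = -z.snd := rfl

@[simp] theorem conjMap_conjMap (z : Complexification K) : conjMap (conjMap z) = z := by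
  ext <;> simp

theorem norm_conjMap (z : Complexification K) : ‖conjMap z‖ = ‖z‖ := by
  refine (sq_eq_sq₀ (norm_nonneg _) (norm_nonneg _)).1 ?_
  simp [norm_sq_eq]

theorem continuous_mk_zero : Continuous fun h : K => (mk h 0 : Complexification K) :=
  (WithLp.prod_continuous_toLp 2 K K).comp (continuous_id.prodMk continuous_const)

end

section

variable {K : Type*} [NormedAddCommGroup K] [InnerProductSpace ℝ K]

theorem inner_def (z w : Complexification K) : ⟪z, w⟫_ℂ =
    ((⟪w.fst, z.fst⟫_ℝ + ⟪w.snd, z.snd⟫_ℝ : ℝ) : ℂ) +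
      I * ((⟪w.snd, z.fst⟫_ℝ - ⟪w.fst, z.snd⟫_ℝ : ℝ) : ℂ) := rfl

theorem conjMap_smul_add (a : ℂ) (z w : Complexification K) :
    conjMap (a • z + w) = conj a • conjMap z + conjMap w := by
  ext
  · simp
  · simp; abel

theorem inner_conjMap_right (z w : Complexification K) :
    ⟪z, conjMap w⟫_ℂ = conj ⟪conjMap z, w⟫_ℂ := by
  simp only [inner_def, fst_conjMap, snd_conjMap]
  apply Complex.ext
  · simp
  · simp [sub_eq_add_neg, add_comm]

@[simp] theorem fst_blockOperator (A B : K →L[ℝ] K) (z : Complexification K) :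
    (blockOperator A B z).fst = A z.fst - B z.snd := rfl
@[simp] theorem snd_blockOperator (A B : K →L[ℝ] K) (z : Complexification K) :
    (blockOperator A B z).snd = B z.fst + A z.snd := rfl

/-- Since (h, g) = (h, 0) + i(g, 0), complex linearity determines T from its values on the vectors
(h, 0); A and B are the components of those values. -/
theorem exists_eq_blockOperator (T : Complexification K →L[ℂ] Complexification K) :
    ∃ A B : K →L[ℝ] K, T = blockOperator A B := by
  have hadd : ∀ h g : K, (mk (h + g) 0 : Complexification K) = mk h 0 + mk g 0 := fun h g => by
    ext <;> simp
  have hsmul : ∀ (r : ℝ) (h : K), (mk (r • h) 0 : Complexification K) = (r : ℂ) • mk h 0 :=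
    fun r h => by ext <;> simp [-Complex.coe_smul]
  let A : K →L[ℝ] K :=
    { toFun := fun h => (T (mk h 0)).fst
      map_add' := fun h g => by simp [hadd]
      map_smul' := fun r h => by simp [hsmul, -Complex.coe_smul]
      cont := continuous_fst.comp (T.continuous.comp continuous_mk_zero) }
  let B : K →L[ℝ] K :=
    { toFun := fun h => (T (mk h 0)).snd
      map_add' := fun h g => by simp [hadd]
      map_smul' := fun r h => by simp [hsmul, -Complex.coe_smul]
      cont := continuous_snd.comp (T.continuous.comp continuous_mk_zero) }
  refine ⟨A, B, ?_⟩
  refine ContinuousLinearMap.ext fun z => ?_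
  have hz : z = mk z.fst 0 + I • mk z.snd 0 := by ext <;> simp
  have hT : T z = T (mk z.fst 0) + I • T (mk z.snd 0) := by
    conv_lhs => rw [hz, map_add, map_smul]
  rw [hT]
  ext
  · simp [A, B, sub_eq_add_neg]
  · simp [A, B]

theorem blockOperator_injective {A B A' B' : K →L[ℝ] K}
    (h : blockOperator A B = blockOperator A' B') : A = A' ∧ B = B' := by
  have h1 : ∀ k : K, blockOperator A B (mk k 0) = blockOperator A' B' (mk k 0) := by simp [h]
  constructor <;> ext k
  · simpa using congrArg fst (h1 k)
  · simpa using congrArg snd (h1 k)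

theorem blockOperator_id_zero :
    blockOperator (ContinuousLinearMap.id ℝ K) 0 = ContinuousLinearMap.id ℂ _ := by
  refine ContinuousLinearMap.ext fun z => ?_
  ext <;> simp

theorem blockOperator_comp (A B A' B' : K →L[ℝ] K) :
    blockOperator A B ∘L blockOperator A' B' =
      blockOperator (A ∘L A' - B ∘L B') (B ∘L A' + A ∘L B') := by
  refine ContinuousLinearMap.ext fun z => ?_
  ext
  · simp; abel
  · simp; abel

theorem conjMap_blockOperator_conjMap (A B : K →L[ℝ] K) (z : Complexification K) :
    conjMap (blockOperator A B (conjMap z)) = blockOperator A (-B) z := by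
  ext
  · simp
  · simp; abel

end

variable {K : Type*} [NormedAddCommGroup K] [InnerProductSpace ℝ K] [CompleteSpace K]

theorem adjoint_blockOperator (A B : K →L[ℝ] K) :
    ContinuousLinearMap.adjoint (blockOperator A B) =
      blockOperator (ContinuousLinearMap.adjoint A) (-ContinuousLinearMap.adjoint B) := by
  symm
  rw [ContinuousLinearMap.eq_adjoint_iff]
  intro z w
  simp only [inner_def, fst_blockOperator, snd_blockOperator, neg_apply, inner_sub_left,
    inner_add_left, inner_sub_right, inner_add_right, inner_neg_right,
    ContinuousLinearMap.adjoint_inner_right]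
  apply Complex.ext
  · simp; ring
  · simp; ring

/-- For W = [[A, -B], [B, A]], W* has blocks (A†, -B†) and J W J has blocks (A, -B), so W* = J W J
encodes self-adjointness. Then W W* has blocks (A² + B², BA - AB), and W W* = I encodes the rest. -/
theorem isSelfAdjointCirclePair_iff (A B : K →L[ℝ] K) :
    IsSelfAdjointCirclePair A B ↔
      (∀ z, ContinuousLinearMap.adjoint (blockOperator A B) z =
        conjMap (blockOperator A B (conjMap z))) ∧
      blockOperator A B ∘L ContinuousLinearMap.adjoint (blockOperator A B) =
        ContinuousLinearMap.id ℂ _ := by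
  simp_rw [conjMap_blockOperator_conjMap, ← ContinuousLinearMap.ext_iff]
  rw [adjoint_blockOperator]
  constructor
  · rintro ⟨hA, hB, hc, hs⟩
    refine ⟨by rw [hA, hB], ?_⟩
    rw [hA, hB, blockOperator_comp, ← blockOperator_id_zero, ← hs]
    simp [hc]
  · rintro ⟨h1, h2⟩
    obtain ⟨hA, hB⟩ := blockOperator_injective h1
    rw [neg_inj] at hB
    rw [hA, hB, blockOperator_comp, ← blockOperator_id_zero] at h2
    obtain ⟨h3, h4⟩ := blockOperator_injective h2
    refine ⟨hA, hB, ?_, ?_⟩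
    · simp only [ContinuousLinearMap.comp_neg] at h4
      exact (sub_eq_zero.1 (by rwa [← sub_eq_add_neg] at h4)).symm
    · simpa using h3

/-- If `conj ∘ T ∘ conj = T*`, then the conjugate orbit of `T` consists of the operators
`W T* W*`, where `W = [[A, -B], [B, A]]` for a self-adjoint circle pair `A`, `B`. -/
theorem mem_conjugateOrbit_iff {T V : Complexification K →L[ℂ] Complexification K}
    (hT : ∀ z, ContinuousLinearMap.adjoint T z = conjMap (T (conjMap z))) :
    V ∈ conjugateOrbit T ↔ ∃ A B : K →L[ℝ] K, IsSelfAdjointCirclePair A B ∧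
      V = blockOperator A B ∘L ContinuousLinearMap.adjoint T ∘L
        ContinuousLinearMap.adjoint (blockOperator A B) := by
  constructor
  · rintro ⟨C, hC, hV⟩
    -- The product C J of two antilinear isometric involutions is a linear unitary with inverse J C.
    let W : Complexification K ≃ₗᵢ[ℂ] Complexification K :=
      { toFun := fun z => C (conjMap z)
        invFun := fun z => conjMap (C z)
        map_add' := fun z w => by
          have h1 := conjMap_smul_add 1 z w
          have h2 := hC.antilinear 1 (conjMap z) (conjMap w)
          simp only [one_smul, map_one] at h1 h2
          rw [h1, h2]
        map_smul' := fun a z => by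
          have h0 : C 0 = 0 := norm_eq_zero.1 (by rw [hC.isometric, norm_zero])
          have h0' : conjMap (0 : Complexification K) = 0 := by ext <;> simp
          have h1 := conjMap_smul_add a z 0
          have h2 := hC.antilinear (conj a) (conjMap z) 0
          simp only [h0, h0', add_zero, Complex.conj_conj] at h1 h2
          rw [h1, h2, RingHom.id_apply]
        left_inv := fun z => by simp [hC.involutive]
        right_inv := fun z => by simp [hC.involutive]
        norm_map' := fun z => (hC.isometric _).trans (norm_conjMap z) }
    obtain ⟨A, B, hAB⟩ := exists_eq_blockOperator (W : Complexification K →L[ℂ] _)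
    have hadj : ∀ z, ContinuousLinearMap.adjoint (blockOperator A B) z = conjMap (C z) := by
      intro z
      rw [← hAB]
      exact congrArg (fun S : Complexification K →L[ℂ] Complexification K => S z)
        (LinearIsometryEquiv.adjoint_eq_symm W)
    have hW : ∀ z, blockOperator A B z = C (conjMap z) := fun z => by rw [← hAB]; rfl
    refine ⟨A, B, (isSelfAdjointCirclePair_iff A B).2 ⟨fun z => ?_, ?_⟩, ?_⟩
    · rw [hadj, hW, conjMap_conjMap]
    · refine ContinuousLinearMap.ext fun z => ?_
      simp [hadj, hW, hC.involutive]
    · refine ContinuousLinearMap.ext fun z => ?_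
      simp [hadj, hW, hT, hV]
  · rintro ⟨A, B, hAB, rfl⟩
    obtain ⟨hadj, hid⟩ := (isSelfAdjointCirclePair_iff A B).1 hAB
    have hinv : ∀ z, blockOperator A B (conjMap (blockOperator A B (conjMap z))) = z := by
      intro z
      rw [← hadj]
      exact congrArg (fun S : Complexification K →L[ℂ] Complexification K => S z) hid
    -- The conjugation is C = W J; it is an involution because W J W J = W W* = I.
    refine ⟨fun z => blockOperator A B (conjMap z), ⟨fun a z w => ?_, hinv, fun z => ?_⟩,
      fun z => ?_⟩
    · simp only [conjMap_smul_add, map_add, map_smul]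
    -- Conjugating W J W J = I by J gives W* W = I, so W preserves norms.
    · have h1 : ∀ y, ContinuousLinearMap.adjoint (blockOperator A B) (blockOperator A B y) = y := by
        intro y
        have := congrArg conjMap (hinv (conjMap y))
        simpa only [hadj, conjMap_conjMap] using this
      rw [← norm_conjMap z]
      refine (sq_eq_sq₀ (norm_nonneg _) (norm_nonneg _)).1 ?_
      rw [← inner_self_eq_norm_sq (𝕜 := ℂ), ← ContinuousLinearMap.adjoint_inner_right, h1,
        inner_self_eq_norm_sq]
    · simp [hadj, hT]

end Complexification

/-! ### Transfer to the complexification of the real form -/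

namespace SpectralMeasure

open Complexification

variable {H : Type*} [NormedAddCommGroup H] [InnerProductSpace ℂ H] [CompleteSpace H]
variable (E : SpectralMeasure H) {ι : Type*} {x : ι → H}

/-- E(Ω)E(Ω')x_k = E(Ω ∩ Ω')x_k is again a generator. This invariance makes E(Ω) act componentwise
on pairs, hence commute with J. -/
theorem proj_mem_realForm_of_mem {Ω : Set Circle} (hΩ : MeasurableSet Ω) {h : H}
    (hh : h ∈ E.realForm x) : E.proj Ω h ∈ E.realForm x := by
  let P : H →ₗ[ℝ] H := (E.proj Ω : H →ₗ[ℂ] H).restrictScalars ℝ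
  have hP : Continuous P := (E.proj Ω).continuous
  have hc : IsClosed (((E.realForm x).comap P : Submodule ℝ H) : Set H) :=
    (Submodule.isClosed_topologicalClosure _).preimage hP
  have hle : E.realForm x ≤ (E.realForm x).comap P := by
    refine Submodule.topologicalClosure_minimal _ (iSup_le fun k => ?_) hc
    refine Submodule.topologicalClosure_minimal _ (Submodule.span_le.2 ?_) hc
    rintro _ ⟨Ω', hΩ', rfl⟩
    have h1 : E.proj Ω (E.proj Ω' (x k)) = E.proj (Ω ∩ Ω') (x k) := by
      rw [E.inter _ _ hΩ hΩ']; rfl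
    change E.proj Ω (E.proj Ω' (x k)) ∈ E.realForm x
    rw [h1]
    exact E.proj_mem_realForm x k (hΩ.inter hΩ')
  exact hle hh

variable (hx : E.IsCyclicDecomposition x)

theorem toComplexification_symm_apply (z : Complexification (E.realForm x)) :
    (E.toComplexification hx).symm z = (z.fst : H) + I • (z.snd : H) := rfl

theorem model_apply (A : H →L[ℂ] H) (z : Complexification (E.realForm x)) :
    E.model hx A z = E.toComplexification hx (A ((E.toComplexification hx).symm z)) := rfl

theorem model_comp (A B : H →L[ℂ] H) :
    E.model hx (A ∘L B) = E.model hx A ∘L E.model hx B := by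
  refine ContinuousLinearMap.ext fun z => ?_
  simp [model_apply]

theorem model_adjoint (A : H →L[ℂ] H) : E.model hx (ContinuousLinearMap.adjoint A) =
    ContinuousLinearMap.adjoint (E.model hx A) := by
  rw [ContinuousLinearMap.eq_adjoint_iff]
  intro z w
  have h1 := LinearIsometryEquiv.inner_map_eq_flip (E.toComplexification hx)
  have h2 := LinearIsometryEquiv.inner_map_eq_flip (E.toComplexification hx).symm
  rw [model_apply, model_apply, h1, ContinuousLinearMap.adjoint_inner_left, h2]
  rfl

theorem model_injective : Function.Injective (E.model hx) := by
  intro A B h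
  refine ContinuousLinearMap.ext fun v => ?_
  have h1 := congrArg
    (fun T : Complexification (E.realForm x) →L[ℂ] _ => T (E.toComplexification hx v)) h
  simpa [model_apply] using h1

theorem model_surjective : Function.Surjective (E.model hx) := by
  intro T
  refine ⟨(E.toComplexification hx).symm.toContinuousLinearEquiv.toContinuousLinearMap ∘L T ∘L
    (E.toComplexification hx).toContinuousLinearEquiv.toContinuousLinearMap, ?_⟩
  refine ContinuousLinearMap.ext fun z => ?_
  simp [model_apply]

theorem model_mem_conjugateOrbit_iff (U V : H →L[ℂ] H) :
    E.model hx V ∈ conjugateOrbit (E.model hx U) ↔ V ∈ conjugateOrbit U := by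
  set e := E.toComplexification hx with he
  constructor
  · rintro ⟨C, hC, hV⟩
    refine ⟨fun v => e.symm (C (e v)), ⟨fun a v w => ?_, fun v => ?_, fun v => ?_⟩, fun v => ?_⟩
    · simp [hC.antilinear]
    · simp [hC.involutive]
    · simp [hC.isometric]
    · have := hV (e v)
      rw [model_apply, model_apply, ← he, e.symm_apply_apply] at this
      simp [← this]
  · rintro ⟨C, hC, hV⟩
    refine ⟨fun v => e (C (e.symm v)), ⟨fun a v w => ?_, fun v => ?_, fun v => ?_⟩, fun v => ?_⟩
    · simp [hC.antilinear]
    · simp [hC.involutive]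
    · simp [hC.isometric]
    · simp [model_apply, ← he, hV]

theorem conjMap_model_proj {Ω : Set Circle} (hΩ : MeasurableSet Ω)
    (z : Complexification (E.realForm x)) :
    conjMap (E.model hx (E.proj Ω) z) = E.model hx (E.proj Ω) (conjMap z) := by
  have key : ∀ h g : E.realForm x, E.model hx (E.proj Ω) (Complexification.mk h g) =
      Complexification.mk ⟨_, E.proj_mem_realForm_of_mem hΩ h.2⟩ ⟨_, E.proj_mem_realForm_of_mem hΩ g.2⟩ := by
    intro h g
    rw [model_apply, toComplexification_symm_apply, fst_mk, snd_mk, map_add, map_smul]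
    exact E.toComplexification_add_I_smul hx ⟨_, E.proj_mem_realForm_of_mem hΩ h.2⟩
      ⟨_, E.proj_mem_realForm_of_mem hΩ g.2⟩
  obtain ⟨h, g, rfl⟩ : ∃ h g, z = Complexification.mk h g := ⟨z.fst, z.snd, rfl⟩
  have h1 : conjMap (Complexification.mk h g) = Complexification.mk h (-g) := rfl
  rw [h1, key, key]
  ext
  · rfl
  · simp

theorem scalarMeasure_symm_conjMap (z : Complexification (E.realForm x)) :
    E.scalarMeasure ((E.toComplexification hx).symm (conjMap z)) =
      E.scalarMeasure ((E.toComplexification hx).symm z) := by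
  ext Ω hΩ
  rw [scalarMeasure_apply _ _ hΩ, scalarMeasure_apply _ _ hΩ,
    ← (E.toComplexification hx).norm_map, ← model_apply, ← conjMap_model_proj E hx hΩ,
    norm_conjMap, model_apply, (E.toComplexification hx).norm_map]

/-- The model of a unitary operator satisfies `conj ∘ U ∘ conj = U*`. -/
theorem adjoint_model_eq {U : H →L[ℂ] H} (hU : E.IsSpectralMeasureOf U)
    (z : Complexification (E.realForm x)) :
    ContinuousLinearMap.adjoint (E.model hx U) z = conjMap (E.model hx U (conjMap z)) := by
  have hq : ∀ z : Complexification (E.realForm x), ⟪z, E.model hx U z⟫_ℂ =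
      ∫ ξ : Circle, (ξ : ℂ) ∂(E.scalarMeasure ((E.toComplexification hx).symm z)) := by
    intro z
    rw [← hU, model_apply]
    exact (LinearIsometryEquiv.inner_map_eq_flip (E.toComplexification hx).symm _ _).symm
  -- The block form exhibits J Û J as a complex linear operator, so that it can be compared with Û*
  -- through quadratic forms.
  obtain ⟨A, B, hAB⟩ := exists_eq_blockOperator (E.model hx U)
  have hblock : ∀ z, conjMap (E.model hx U (conjMap z)) = blockOperator A (-B) z := by
    intro z
    rw [hAB, conjMap_blockOperator_conjMap]
  rw [hblock]
  suffices h : ContinuousLinearMap.adjoint (E.model hx U) = blockOperator A (-B) by rw [h]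
  apply ContinuousLinearMap.coe_injective
  rw [← ext_inner_map]
  intro y
  rw [ContinuousLinearMap.coe_coe, ContinuousLinearMap.coe_coe,
    ContinuousLinearMap.adjoint_inner_left, ← hblock, ← inner_conj_symm (conjMap _) y,
    inner_conjMap_right, Complex.conj_conj, hq, hq, scalarMeasure_symm_conjMap]

end SpectralMeasure

end

theorem mainTheorem5 {H : Type*} [NormedAddCommGroup H] [InnerProductSpace ℂ H]
    [CompleteSpace H] [TopologicalSpace.SeparableSpace H]
    (U : H →L[ℂ] H) (hU : U ∈ unitary (H →L[ℂ] H)) :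
    (∃ E : SpectralMeasure H, E.IsSpectralMeasureOf U) ∧
    ∀ E : SpectralMeasure H, E.IsSpectralMeasureOf U →
      (∃ (N : Set ℕ) (x : N → H), E.IsCyclicDecomposition x) ∧
      ∀ {ι : Type*} (x : ι → H) (hx : E.IsCyclicDecomposition x),
      ∀ V ∈ unitary (H →L[ℂ] H),
        List.TFAE [
          V ∈ conjugateOrbit U,
          ∃ (W : H →L[ℂ] H) (Wr Wc : E.realForm x →L[ℝ] E.realForm x),
            IsSelfAdjointCirclePair Wr Wc ∧
            E.model hx W = Complexification.blockOperator Wr Wc ∧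
            V = W ∘L ContinuousLinearMap.adjoint U ∘L ContinuousLinearMap.adjoint W,
          ∃ Wr Wc : E.realForm x →L[ℝ] E.realForm x,
            IsSelfAdjointCirclePair Wr Wc ∧
            E.model hx V = Complexification.blockOperator Wr Wc ∘L
              ContinuousLinearMap.adjoint (E.model hx U) ∘L
              ContinuousLinearMap.adjoint (Complexification.blockOperator Wr Wc)] := by
  refine ⟨SpectralMeasure.exists_isSpectralMeasureOf hU, fun E hE =>
    ⟨E.exists_isCyclicDecomposition, fun {ι} x hx V _ => ?_⟩⟩
  tfae_have 1 ↔ 3 := by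
    rw [← E.model_mem_conjugateOrbit_iff hx,
      Complexification.mem_conjugateOrbit_iff (E.adjoint_model_eq hx hE)]
  -- The model map A ↦ X A X⁻¹ respects products and adjoints and is bijective, so the two
  -- factorizations correspond.
  tfae_have 2 → 3 := by
    rintro ⟨W, A, B, hAB, hW, rfl⟩
    refine ⟨A, B, hAB, ?_⟩
    rw [E.model_comp, E.model_comp, E.model_adjoint, E.model_adjoint, hW]
  tfae_have 3 → 2 := by
    rintro ⟨A, B, hAB, hV⟩
    obtain ⟨W, hW⟩ := E.model_surjective hx (Complexification.blockOperator A B)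
    refine ⟨W, A, B, hAB, hW, E.model_injective hx ?_⟩
    rw [E.model_comp, E.model_comp, E.model_adjoint, E.model_adjoint, hW, hV]
  tfae_finish
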